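/- \textbf{Definitions.} Fix $d$ and let $\mathcal M^d=\bigcup_{n\ge 1} M_n(\mathbb C)^d$. A \emph{free set} is a set $D\subseteq\mathcal M^d$ closed under direct sums $X\oplus Y$ and under unitary conjugation $U^*XU$; write $D_n=D\cap M_n(\mathbb C)^d$. We say $D$ is open (connected, simply connected) if each nonempty $D_n$ is. A \emph{tracial free function} on $B$ is a function $f:B\to\mathbb C$ with $f(X\oplus Y)=f(X)+f(Y)$ and $f(U^*XU)=f(X)$ for unitary $U$. An open connected free set $D$ is \emph{anchored} if it contains a nonempty open simply connected free subset $B$, called an \emph{anchor}. A \emph{global germ} is a tracial free function $f$ on $B$ which analytically continues along every path in $D$ (that is, in some $D_N$) that starts in $B$. A path $\gamma$ in some $D_N$ \emph{essentially takes} $X$ to $Y$ if $\gamma(0)=X^{\oplus k}$ and $\gamma(1)=Y^{\oplus l}$ for some integers $k,l\ge1$. For a global germ $f$ and such a $\gamma$ with $X\in B$, let $f(\gamma)$ be $\frac1l$ times the terminal value of the analytic continuation of $f$ along $\gamma$. If $\gamma_1$ essentially takes $X$ to $Y$ and $\gamma_2$ essentially takes $Y$ to $Z$, the product $\gamma_2\gamma_1$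 is the concatenation of $\gamma_1^{\oplus m_2}$ followed by $\gamma_2^{\oplus m_1}$, with $m_1,m_2\ge 1$ chosen to make the sizes compatible. Two paths $\gamma_1,\gamma_2$ essentially taking $X\in B$ to $Y\in D$ are \emph{trace equivalent} if $f(\gamma_3\gamma_1)=f(\gamma_3\gamma_2)$ for every global germ $f$, every $Z\in D$ and every path $\gamma_3$ essentially taking $Y$ to $Z$. For an anchor $B$ of $D$ and an anchor point $X\in B$, the \emph{tracial fundamental group} $\pi_1^{\mathrm{tr}}(D)$ is the set of trace equivalence classes of paths essentially taking $X$ to $X$, with the product induced by concatenation. \textbf{Theorem.} Let $D$ be an anchored free set, with any anchor $B$ and any anchor point $X\in B$. The concatenation product is well defined on trace equivalence classes and makes $\pi_1^{\mathrm{tr}}(D)$ a group, whose identity is the class of the trivial path at $X$ and in which inverses are given by reversing paths. This group is a countable, torsion-free, divisible abelian group. Hence it is isomorphic to a direct sum of copies of $\mathbb Q$. -/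

import Mathlib

open scoped Topology unitInterval Kronecker DirectSum Matrix.Norms.Elementwise

noncomputable section

namespace TracialFree

/-! ### The matrix universe -/

/-- `d`-tuples of `n × n` complex matrices. (The topology is the usual one; the norm, which is the
maximum of the moduli of the entries, only serves to speak of analytic functions.) -/
abbrev MatTuple (d n : ℕ) : Type := Fin d → Matrix (Fin n) (Fin n) ℂ

/-- The direct sum `X ⊕ Y`, coordinatewise block diagonal. -/
def directSum {d m n : ℕ} (X : MatTuple d m) (Y : MatTuple d n) : MatTuple d (m + n) :=
  fun c => Matrix.reindex finSumFinEquiv finSumFinEquiv (Matrix.fromBlocks (X c) 0 0 (Y c))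

/-- The coordinatewise conjugation `U* X U`. -/
def conj {d n : ℕ} (U : Matrix (Fin n) (Fin n) ℂ) (X : MatTuple d n) : MatTuple d n :=
  fun c => star U * X c * U

/-- The `k`-fold direct sum `X^{⊕k} = X ⊕ ⋯ ⊕ X`, a block diagonal tuple of size `N = k * n`. -/
def ampl {d n : ℕ} (k : ℕ) {N : ℕ} (h : k * n = N) (X : MatTuple d n) : MatTuple d N :=
  fun c => Matrix.reindex (finProdFinEquiv.trans (finCongr h)) (finProdFinEquiv.trans (finCongr h))
    ((1 : Matrix (Fin k) (Fin k) ℂ) ⊗ₖ X c)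

/-- A free set: a subset `D = ⋃ₙ Dₙ` of the matrix universe (matrices of size at least `1`), closed
under direct sums and under unitary conjugation. -/
structure FreeSet (d : ℕ) where
  /-- the part `Dₙ` of the set that consists of tuples of `n × n` matrices -/
  level : ∀ n : ℕ, Set (MatTuple d n)
  level_zero : level 0 = ∅
  directSum_mem : ∀ {m n : ℕ} {X : MatTuple d m} {Y : MatTuple d n},
    X ∈ level m → Y ∈ level n → directSum X Y ∈ level (m + n)
  conj_mem : ∀ {n : ℕ} {X : MatTuple d n} {U : Matrix (Fin n) (Fin n) ℂ},
    X ∈ level n → U ∈ Matrix.unitaryGroup (Fin n) ℂ → conj U X ∈ level n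

namespace FreeSet

variable {d : ℕ}

/-- `D` is open: each `Dₙ` is open. -/
def IsOpen (D : FreeSet d) : Prop := ∀ n, _root_.IsOpen (D.level n)

/-- `D` is connected: each `Dₙ` is connected (some of the `Dₙ` may be empty). -/
def IsConnected (D : FreeSet d) : Prop := ∀ n, IsPreconnected (D.level n)

/-- `D` is simply connected: each `Dₙ` is simply connected (some of the `Dₙ` may be empty). -/
def IsSimplyConnected (D : FreeSet d) : Prop :=
  ∀ n, (D.level n).Nonempty → _root_.IsSimplyConnected (D.level n)

/-- `B` is an anchor of `D`: a nonempty open simply connected free subset of `D`. -/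
structure IsAnchor (D B : FreeSet d) : Prop where
  subset : ∀ n, B.level n ⊆ D.level n
  nonempty : ∃ n, (B.level n).Nonempty
  isOpen : B.IsOpen
  isSimplyConnected : B.IsSimplyConnected

end FreeSet

/-! ### Facts on direct sums that the definitions below need -/

section Facts

variable {d : ℕ}

theorem ampl_apply {n k N : ℕ} (h : k * n = N) (X : MatTuple d n) (c : Fin d) (i j : Fin N) :
    ampl k h X c i j =
      if (i : ℕ) / n = (j : ℕ) / n then
        X c (finProdFinEquiv.symm (Fin.cast h.symm i)).2 (finProdFinEquiv.symm (Fin.cast h.symm j)).2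
      else 0 := by
  subst h
  simp [ampl, Matrix.kroneckerMap_apply, Matrix.one_apply, Fin.ext_iff, Fin.divNat]

theorem continuous_ampl {n k N : ℕ} (h : k * n = N) :
    Continuous (ampl k h : MatTuple d n → MatTuple d N) := by
  refine continuous_pi fun c => continuous_matrix fun i j => ?_
  simp only [ampl_apply]
  split_ifs
  · exact ((continuous_apply c).matrix_elem _ _)
  · exact continuous_const

theorem ampl_one {n : ℕ} (h : 1 * n = n) (X : MatTuple d n) : ampl 1 h X = X := by
  funext c; ext i j
  have hi := i.2
  have hj := j.2
  rw [ampl_apply, if_pos (by rw [Nat.div_eq_of_lt hi, Nat.div_eq_of_lt hj])]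
  congr 1 <;> simp [Fin.modNat, Nat.mod_eq_of_lt]

theorem ampl_succ {n k N : ℕ} (h : k * n = N) (h' : (k + 1) * n = N + n) (X : MatTuple d n) :
    ampl (k + 1) h' X = directSum (ampl k h X) X := by
  subst h
  funext c; ext i j
  have hn : 0 < n := by
    rcases Nat.eq_zero_or_pos n with rfl | hn
    · exact absurd i.2 (by simp)
    · exact hn
  rw [ampl_apply]
  have hc : ∀ a : Fin (k * n), (a : ℕ) / n < k := fun a => Nat.div_lt_of_lt_mul (by
    have := a.2
    rwa [Nat.mul_comm n k])
  have ha : ∀ a : Fin n, (k * n + (a : ℕ)) / n = k := fun a => by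
    rw [Nat.mul_comm, Nat.mul_add_div hn, Nat.div_eq_of_lt a.2, Nat.add_zero]
  induction i using Fin.addCases with
  | left i =>
    induction j using Fin.addCases with
    | left j =>
      simp only [directSum, Matrix.reindex_apply, Matrix.submatrix_apply,
        finSumFinEquiv_symm_apply_castAdd, Matrix.fromBlocks_apply₁₁, ampl_apply, Fin.val_castAdd]
      rfl
    | right j =>
      have := hc i
      simp only [directSum, Matrix.reindex_apply, Matrix.submatrix_apply,
        finSumFinEquiv_symm_apply_castAdd, finSumFinEquiv_symm_apply_natAdd,
        Matrix.fromBlocks_apply₁₂, Fin.val_castAdd, Fin.val_natAdd, ha]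
      rw [if_neg (by omega)]; rfl
  | right i =>
    induction j using Fin.addCases with
    | left j =>
      have := hc j
      simp only [directSum, Matrix.reindex_apply, Matrix.submatrix_apply,
        finSumFinEquiv_symm_apply_castAdd, finSumFinEquiv_symm_apply_natAdd,
        Matrix.fromBlocks_apply₂₁, Fin.val_castAdd, Fin.val_natAdd, ha]
      rw [if_neg (by omega)]; rfl
    | right j =>
      simp only [directSum, Matrix.reindex_apply, Matrix.submatrix_apply,
        finSumFinEquiv_symm_apply_natAdd, Matrix.fromBlocks_apply₂₂, Fin.val_natAdd, ha, if_true]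
      congr 1 <;> simp [Fin.modNat, Nat.mod_eq_of_lt]

theorem FreeSet.ampl_mem (D : FreeSet d) {n k N : ℕ} (h : k * n = N) (hk : 0 < k)
    {X : MatTuple d n} (hX : X ∈ D.level n) : ampl k h X ∈ D.level N := by
  induction k, hk using Nat.le_induction generalizing N with
  | base =>
    obtain rfl : n = N := by omega
    rw [ampl_one]; exact hX
  | succ k hk ih =>
    obtain rfl : k * n + n = N := by rw [← h]; ring
    rw [ampl_succ rfl h]
    exact D.directSum_mem (ih rfl) hX

theorem ampl_ampl {n k k' N M : ℕ} (h : k * n = N) (h' : k' * N = M) (h'' : (k' * k) * n = M)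
    (X : MatTuple d n) : ampl k' h' (ampl k h X) = ampl (k' * k) h'' X := by
  subst h
  subst h'
  funext c; ext i j
  have e : k * n = n * k := Nat.mul_comm _ _
  have hdm : ∀ a : ℕ, a / (k * n) = a / n / k := fun a => by rw [e, Nat.div_div_eq_div_mul]
  have hmd : ∀ a : ℕ, a % (k * n) / n = a / n % k := fun a => by rw [e, Nat.mod_mul_right_div_self]
  simp only [ampl_apply, finProdFinEquiv_symm_apply, Fin.val_cast, Fin.modNat, hdm, hmd]
  by_cases hij : (i : ℕ) / n = (j : ℕ) / n
  · rw [if_pos (by rw [hij]), if_pos (by rw [hij]), if_pos hij]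
    congr 1 <;> simp
  · rw [if_neg hij]
    by_cases h1 : (i : ℕ) / n / k = (j : ℕ) / n / k
    · rw [if_pos h1, if_neg]
      intro h2
      apply hij
      rw [← Nat.div_add_mod ((i : ℕ) / n) k, ← Nat.div_add_mod ((j : ℕ) / n) k, h1, h2]
    · rw [if_neg h1]

end Facts

/-! ### Analytic continuation along paths and global germs -/

/-- `F` is an analytic continuation along the path `γ` of the germ of `f` at `γ 0`: the function `F t`
is analytic near `γ t`, the germ of `F 0` at `γ 0` is that of `f`, and for `s` close to `t` the
functions `F s` and `F t` have the same germ at `γ s`. -/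
structure IsAnalyticContinuation {E : Type*} [NormedAddCommGroup E] [NormedSpace ℂ E]
    (f : E → ℂ) (γ : I → E) (F : I → E → ℂ) : Prop where
  analyticAt : ∀ t, AnalyticAt ℂ (F t) (γ t)
  initial : F 0 =ᶠ[𝓝 (γ 0)] f
  compatible : ∀ t, ∀ᶠ s in 𝓝 t, F s =ᶠ[𝓝 (γ s)] F t

/-- The germs of an analytic continuation along a path are uniquely determined. -/
theorem IsAnalyticContinuation.unique {E : Type*} [NormedAddCommGroup E] [NormedSpace ℂ E]
    {f : E → ℂ} {γ : I → E} (hcont : Continuous γ) {F G : I → E → ℂ}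
    (hF : IsAnalyticContinuation f γ F) (hG : IsAnalyticContinuation f γ G) (t : I) :
    F t =ᶠ[𝓝 (γ t)] G t := by
  have hγ : ∀ (t : I) {p : E → Prop}, (∀ᶠ z in 𝓝 (γ t), p z) →
      ∀ᶠ s in 𝓝 t, ∀ᶠ z in 𝓝 (γ s), p z := fun t p hp =>
    hcont.continuousAt.eventually hp.eventually_nhds
  have hclopen : IsClopen {t : I | F t =ᶠ[𝓝 (γ t)] G t} := by
    constructor
    · rw [isClosed_iff_frequently]
      intro t ht
      obtain ⟨r, hr, hball⟩ := Metric.eventually_nhds_iff_ball.1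
        ((hF.analyticAt t).eventually_analyticAt.and (hG.analyticAt t).eventually_analyticAt)
      have hmem : ∀ᶠ s in 𝓝 t, γ s ∈ Metric.ball (γ t) r :=
        hcont.continuousAt.eventually (Metric.ball_mem_nhds _ hr)
      obtain ⟨s, hs, hs1, hs2, hs3⟩ :=
        (ht.and_eventually ((hF.compatible t).and ((hG.compatible t).and hmem))).exists
      have hst : F t =ᶠ[𝓝 (γ s)] G t := hs1.symm.trans (Filter.EventuallyEq.trans hs hs2)
      have heq : Set.EqOn (F t) (G t) (Metric.ball (γ t) r) :=
        AnalyticOnNhd.eqOn_of_preconnected_of_eventuallyEq (𝕜 := ℂ) (fun z hz => (hball z hz).1)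
          (fun z hz => (hball z hz).2) (convex_ball (γ t) r).isPreconnected hs3 hst
      exact heq.eventuallyEq_of_mem (Metric.ball_mem_nhds _ hr)
    · rw [isOpen_iff_mem_nhds]
      intro t ht
      filter_upwards [hF.compatible t, hG.compatible t, hγ t ht] with s h1 h2 h3
      exact h1.trans (Filter.EventuallyEq.trans h3 h2.symm)
  have h0 : (0 : I) ∈ {t : I | F t =ᶠ[𝓝 (γ t)] G t} := by
    exact hF.initial.trans hG.initial.symm
  have h1 : t ∈ {t : I | F t =ᶠ[𝓝 (γ t)] G t} := by
    rw [hclopen.eq_univ ⟨0, h0⟩]; exact Set.mem_univ t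
  exact h1

variable {d : ℕ}

/-- `f` is a tracial free function on the free set `B`. (Values of `f` off `B` are irrelevant.) -/
structure IsTracialFree (B : FreeSet d) (f : ∀ n : ℕ, MatTuple d n → ℂ) : Prop where
  map_directSum : ∀ {m n : ℕ} {X : MatTuple d m} {Y : MatTuple d n},
    X ∈ B.level m → Y ∈ B.level n → f (m + n) (directSum X Y) = f m X + f n Y
  map_conj : ∀ {n : ℕ} {X : MatTuple d n} {U : Matrix (Fin n) (Fin n) ℂ},
    X ∈ B.level n → U ∈ Matrix.unitaryGroup (Fin n) ℂ → f n (conj U X) = f n X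

/-- `f` is a global germ: a tracial free function on `B` that analytically continues along every path
in `D` with initial point in `B`. (In particular `f` is analytic on `B`: take constant paths.) -/
structure IsGlobalGerm (D B : FreeSet d) (f : ∀ n : ℕ, MatTuple d n → ℂ) : Prop where
  isTracialFree : IsTracialFree B f
  continues : ∀ {n : ℕ} {x y : MatTuple d n} (γ : Path x y), x ∈ B.level n →
    (∀ t, γ t ∈ D.level n) → ∃ F, IsAnalyticContinuation (f n) γ F

/-! ### Paths essentially taking `X` to `Y` -/

/-- A path in `D` essentially taking `X` to `Y`: a path `γ` in some `D_N` with
`γ 0 = X^{⊕k}` and `γ 1 = Y^{⊕l}` for some positive integers `k` and `l`. -/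
structure EssPath (D : FreeSet d) {n m : ℕ} (X : MatTuple d n) (Y : MatTuple d m) where
  size : ℕ
  k : ℕ
  l : ℕ
  k_pos : 0 < k
  l_pos : 0 < l
  source_size : k * n = size
  target_size : l * m = size
  path : Path (ampl k source_size X) (ampl l target_size Y)
  mem : ∀ t, path t ∈ D.level size

namespace EssPath

variable {D : FreeSet d} {n m p : ℕ} {X : MatTuple d n} {Y : MatTuple d m} {Z : MatTuple d p}

theorem comp_size (γ₂ : EssPath D Y Z) (γ₁ : EssPath D X Y) :
    γ₁.l * γ₂.size = γ₂.k * γ₁.size := by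
  rw [← γ₂.source_size, ← γ₁.target_size]; ring

theorem comp_middle (γ₂ : EssPath D Y Z) (γ₁ : EssPath D X Y) :
    ampl γ₂.k rfl (ampl γ₁.l γ₁.target_size Y) =
      ampl γ₁.l (comp_size γ₂ γ₁) (ampl γ₂.k γ₂.source_size Y) := by
  rw [ampl_ampl _ _ (by rw [Nat.mul_assoc, γ₁.target_size]),
    ampl_ampl _ _ (by rw [Nat.mul_assoc, γ₂.source_size, comp_size γ₂ γ₁])]
  congr 1
  exact Nat.mul_comm _ _

/-- The concatenation product `γ₂γ₁`: first `γ₁^{⊕m₂}`, then `γ₂^{⊕m₁}`. If `γ₁` ends at `Y^{⊕l₁}`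
and `γ₂` starts at `Y^{⊕k₂}`, sizes are made compatible by `m₂ = k₂` and `m₁ = l₁`. -/
def comp (γ₂ : EssPath D Y Z) (γ₁ : EssPath D X Y) : EssPath D X Z where
  size := γ₂.k * γ₁.size
  k := γ₂.k * γ₁.k
  l := γ₁.l * γ₂.l
  k_pos := Nat.mul_pos γ₂.k_pos γ₁.k_pos
  l_pos := Nat.mul_pos γ₁.l_pos γ₂.l_pos
  source_size := by rw [Nat.mul_assoc, γ₁.source_size]
  target_size := by
    rw [Nat.mul_assoc, γ₂.target_size, ← γ₂.source_size, ← γ₁.target_size]; ring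
  path := ((γ₁.path.map (continuous_ampl rfl)).cast (ampl_ampl _ _ _ _).symm rfl).trans
    ((γ₂.path.map (continuous_ampl (comp_size γ₂ γ₁))).cast (comp_middle γ₂ γ₁)
      (ampl_ampl _ _ _ _).symm)
  mem t := by
    rw [Path.trans_apply]
    split_ifs
    · exact D.ampl_mem rfl γ₂.k_pos (γ₁.mem _)
    · exact D.ampl_mem _ γ₁.l_pos (γ₂.mem _)

/-- The trivial path `γ^X` at a point `X` of `D`. -/
def refl (X : MatTuple d n) (hX : X ∈ D.level n) : EssPath D X X where
  size := n
  k := 1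
  l := 1
  k_pos := one_pos
  l_pos := one_pos
  source_size := Nat.one_mul n
  target_size := Nat.one_mul n
  path := Path.refl _
  mem _ := D.ampl_mem _ one_pos hX

/-- The reversed path, essentially taking `Y` to `X`. -/
def symm (γ : EssPath D X Y) : EssPath D Y X where
  size := γ.size
  k := γ.l
  l := γ.k
  k_pos := γ.l_pos
  l_pos := γ.k_pos
  source_size := γ.target_size
  target_size := γ.source_size
  path := γ.path.symm
  mem _ := γ.mem _

open Classical in
/-- `f(γ)`: the value at the end of `γ` of the analytic continuation of `f` along `γ`, multiplied by
`1 / l`. (The continuation exists if `f` is a global germ and `X ∈ B`, and its terminal value does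
not depend on the choice made here, by `IsAnalyticContinuation.unique`.) -/
def value (f : ∀ n : ℕ, MatTuple d n → ℂ) (γ : EssPath D X Y) : ℂ :=
  if h : ∃ F, IsAnalyticContinuation (f γ.size) γ.path F then
    (h.choose 1 (ampl γ.l γ.target_size Y)) / γ.l
  else 0

theorem value_eq {f : ∀ n : ℕ, MatTuple d n → ℂ} {γ : EssPath D X Y} {F : I → MatTuple d γ.size → ℂ}
    (hF : IsAnalyticContinuation (f γ.size) γ.path F) :
    γ.value f = F 1 (ampl γ.l γ.target_size Y) / γ.l := by
  have h : ∃ F, IsAnalyticContinuation (f γ.size) γ.path F := ⟨F, hF⟩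
  rw [value, dif_pos h]
  have h1 := (h.choose_spec.unique γ.path.continuous hF 1).eq_of_nhds
  have h2 : γ.path 1 = ampl γ.l γ.target_size Y := γ.path.target
  rw [h2] at h1
  rw [h1]

/-- Trace equivalence of two paths essentially taking `X ∈ B` to `Y`: no global germ, continued along
the paths and then along any further path in `D`, distinguishes them. -/
def TraceEquiv (B : FreeSet d) (γ₁ γ₂ : EssPath D X Y) : Prop :=
  ∀ f : (∀ n : ℕ, MatTuple d n → ℂ), IsGlobalGerm D B f →
    ∀ (p : ℕ) (Z : MatTuple d p), Z ∈ D.level p →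
      ∀ γ₃ : EssPath D Y Z, (γ₃.comp γ₁).value f = (γ₃.comp γ₂).value f

/-- Trace equivalence as an equivalence relation. -/
def traceSetoid (D B : FreeSet d) (X : MatTuple d n) (Y : MatTuple d m) :
    Setoid (EssPath D X Y) where
  r := TraceEquiv B
  iseqv :=
    { refl := fun _ _ _ _ _ _ _ => rfl
      symm := fun h f hf p Z hZ γ₃ => (h f hf p Z hZ γ₃).symm
      trans := fun h h' f hf p Z hZ γ₃ => (h f hf p Z hZ γ₃).trans (h' f hf p Z hZ γ₃) }

end EssPath

/-- The underlying set of the tracial fundamental group of `D` with anchor `B` and anchor point `X`: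
trace equivalence classes of paths in `D` essentially taking `X` to `X`. -/
def TracialFundamentalGroup (D B : FreeSet d) {n : ℕ} (X : MatTuple d n) : Type :=
  Quotient (EssPath.traceSetoid D B X X)

/-- The class of a path in the tracial fundamental group. -/
def TracialFundamentalGroup.mk {D : FreeSet d} (B : FreeSet d) {n : ℕ} {X : MatTuple d n}
    (γ : EssPath D X X) : TracialFundamentalGroup D B X :=
  Quotient.mk (EssPath.traceSetoid D B X X) γ

end TracialFree

end

/-! The heart of the matter is that continuing a global germ `f` along a loop at `y` only adds a
constant (`IsGlobalGerm.continuation_loop`). If `γ` is such a loop, conjugating `γ ⊕ y` by rotations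
of the two blocks deforms it into `y ⊕ γ` inside `D`, with both ends fixed at `y ⊕ y`. By homotopy
invariance the two continuations agree near `y ⊕ y`, and on `z ⊕ y` this reads `F 1 z + f y = f z +
F 1 y`.

Hence increments along essential loops add (`value_comp`). Sending a path `γ` to the function `f ↦
f(γ) - f(X)` on global germs, its `monodromy`, turns concatenation into addition and reversal into
negation, and two paths are trace equivalent exactly when their monodromies agree
(`traceEquiv_iff`). So the tracial fundamental group is an additive subgroup of a complex vector
space of functions, and therefore abelian and torsion-free.

Divisibility comes from the normalisation `1 / l`: adding constant summands `X` to a loop keeps the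
total increment of `f` and enlarges `l` (`exists_monodromy_div`). Countability holds because
monodromy is locally constant on each space of paths with given ends, and these spaces are second
countable. The group is thus a countable rational vector space, and a basis gives the direct sum. -/

namespace TracialFree

/-! ### Analytic continuation: formal properties -/

namespace IsAnalyticContinuation

variable {E E' : Type*} [NormedAddCommGroup E] [NormedSpace ℂ E] [NormedAddCommGroup E']
  [NormedSpace ℂ E'] {f g : E → ℂ} {γ : I → E} {F G : I → E → ℂ}

theorem congr_initial (hF : IsAnalyticContinuation f γ F) (h : f =ᶠ[𝓝 (γ 0)] g) :
    IsAnalyticContinuation g γ F :=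
  ⟨hF.analyticAt, hF.initial.trans h, hF.compatible⟩

theorem add (hF : IsAnalyticContinuation f γ F) (hG : IsAnalyticContinuation g γ G) :
    IsAnalyticContinuation (fun z => f z + g z) γ (fun t z => F t z + G t z) where
  analyticAt t := (hF.analyticAt t).add (hG.analyticAt t)
  initial := by
    filter_upwards [hF.initial, hG.initial] with z h1 h2
    rw [h1, h2]
  compatible t := by
    filter_upwards [hF.compatible t, hG.compatible t] with s h1 h2
    filter_upwards [h1, h2] with z h1 h2
    rw [h1, h2]

theorem of_analyticAt (h : ∀ t, AnalyticAt ℂ f (γ t)) :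
    IsAnalyticContinuation f γ (fun _ => f) :=
  ⟨h, Filter.EventuallyEq.rfl, fun _ => Filter.Eventually.of_forall fun _ => Filter.EventuallyEq.rfl⟩

/-- Applied to `directSumL` and to the two projections, this transfers continuations along a direct
sum and along its summands to the product space, where they can be compared. -/
theorem comp_clm (L : E' →L[ℂ] E) {γ : I → E'} (hF : IsAnalyticContinuation f (fun t => L (γ t)) F) :
    IsAnalyticContinuation (fun z => f (L z)) γ (fun t z => F t (L z)) where
  analyticAt t := (hF.analyticAt t).fun_comp (L.analyticAt _)
  initial := L.continuous.continuousAt.eventually hF.initial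
  compatible t := by
    filter_upwards [hF.compatible t] with s h
    exact L.continuous.continuousAt.eventually h

/-- `φ` need not fix the endpoints, so this covers both the halves of a concatenation and reversal.
-/
theorem reparam (hF : IsAnalyticContinuation f γ F) {φ : I → I} (hφ : Continuous φ) :
    IsAnalyticContinuation (F (φ 0)) (fun t => γ (φ t)) (fun t => F (φ t)) where
  analyticAt _ := hF.analyticAt _
  initial := Filter.EventuallyEq.rfl
  compatible t := hφ.continuousAt.eventually (hF.compatible (φ t))

/-- An analytic continuation can be represented by functions that are analytic on balls of a common
radius. -/
theorem exists_uniform_radius (hF : IsAnalyticContinuation f γ F) (hγ : Continuous γ) :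
    ∃ ρ > 0, ∃ G : I → E → ℂ, (∀ t, AnalyticOnNhd ℂ (G t) (Metric.ball (γ t) ρ)) ∧
      ∀ t, G t =ᶠ[𝓝 (γ t)] F t := by
  -- The factor 2 leaves room for a ball of radius at most `ρ t` around any point of the ball of
  -- radius `ρ t`.
  have key : ∀ t : I, ∃ ρ > 0, AnalyticOnNhd ℂ (F t) (Metric.ball (γ t) (2 * ρ)) := fun t => by
    obtain ⟨r, hr, h⟩ := Metric.eventually_nhds_iff_ball.1 (hF.analyticAt t).eventually_analyticAt
    exact ⟨r / 2, half_pos hr, fun z hz => h z (by rwa [mul_div_cancel₀ _ two_ne_zero] at hz)⟩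
  choose ρ hρ han using key
  have hN : ∀ t : I, {s | F s =ᶠ[𝓝 (γ s)] F t ∧ γ s ∈ Metric.ball (γ t) (ρ t)} ∈ 𝓝 t := fun t =>
    (hF.compatible t).and (hγ.continuousAt.eventually (Metric.ball_mem_nhds _ (hρ t)))
  obtain ⟨T, -, hT⟩ := isCompact_univ.elim_nhds_subcover _ fun t _ => hN t
  have hcov : ∀ s : I, ∃ t ∈ T, F s =ᶠ[𝓝 (γ s)] F t ∧ γ s ∈ Metric.ball (γ t) (ρ t) := fun s => by
    obtain ⟨t, ht, h⟩ := Set.mem_iUnion₂.1 (hT (Set.mem_univ s))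
    exact ⟨t, ht, h⟩
  choose τ hτ hτF hτγ using hcov
  obtain ⟨r, hr, hrT⟩ : ∃ r > 0, ∀ t ∈ T, r ≤ ρ t := by
    obtain ⟨t₀, ht₀, h⟩ := T.exists_min_image ρ ⟨τ 0, hτ 0⟩
    exact ⟨ρ t₀, hρ t₀, h⟩
  -- Only finitely many functions `F (τ t)` occur, so the least of their radii serves for all `t`.
  refine ⟨r, hr, fun t => F (τ t), fun t => (han (τ t)).mono ?_, fun t => (hτF t).symm⟩
  refine Metric.ball_subset_ball' ?_
  have h1 := hrT _ (hτ t)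
  have h2 := (Metric.mem_ball.1 (hτγ t)).le
  linarith

/-- Analytic continuation is stable under small perturbations of the path. -/
theorem exists_perturbation (hF : IsAnalyticContinuation f γ F) (hγ : Continuous γ) :
    ∃ ρ > 0, ∀ δ : I → E, Continuous δ → δ 0 = γ 0 → (∀ t, dist (δ t) (γ t) < ρ) →
      ∃ G, IsAnalyticContinuation f δ G ∧ G 1 =ᶠ[𝓝 (γ 1)] F 1 := by
  obtain ⟨ρ, hρ, G, hG, hGF⟩ := hF.exists_uniform_radius hγ
  -- The same functions `G t` continue `f` along `δ`. For `s` near `t`, `G s` and `G t` agree near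
  -- `γ s`, hence on the whole convex intersection of their balls, which contains `δ s`.
  refine ⟨ρ / 2, half_pos hρ, fun δ hδ h0 hd => ⟨G, ⟨fun t => hG t _ ?_, ?_, fun t => ?_⟩, hGF 1⟩⟩
  · exact Metric.ball_subset_ball (by linarith) (hd t)
  · rw [h0]
    exact (hGF 0).trans hF.initial
  · have hnear : ∀ᶠ s in 𝓝 t, γ s ∈ Metric.ball (γ t) (ρ / 2) :=
      hγ.continuousAt.eventually (Metric.ball_mem_nhds _ (half_pos hρ))
    have hGt : ∀ᶠ s in 𝓝 t, G t =ᶠ[𝓝 (γ s)] F t :=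
      hγ.continuousAt.eventually (hGF t).eventually_nhds
    filter_upwards [hnear, hGt, hF.compatible t] with s hs h1 h2
    have hst : G s =ᶠ[𝓝 (γ s)] G t := ((hGF s).trans h2).trans h1.symm
    have hmem : γ s ∈ Metric.ball (γ s) ρ ∩ Metric.ball (γ t) ρ :=
      ⟨Metric.mem_ball_self hρ, Metric.ball_subset_ball (by linarith) hs⟩
    have heq : Set.EqOn (G s) (G t) (Metric.ball (γ s) ρ ∩ Metric.ball (γ t) ρ) :=
      AnalyticOnNhd.eqOn_of_preconnected_of_eventuallyEq (𝕜 := ℂ)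
        ((hG s).mono Set.inter_subset_left) ((hG t).mono Set.inter_subset_right)
        ((convex_ball _ _).inter (convex_ball _ _)).isPreconnected hmem hst
    refine heq.eventuallyEq_of_mem ((Metric.isOpen_ball.inter Metric.isOpen_ball).mem_nhds ⟨?_, ?_⟩)
    · exact Metric.ball_subset_ball (by linarith) (hd s)
    · have h3 := hd s
      have h4 := Metric.mem_ball.1 hs
      have h5 := dist_triangle (δ s) (γ s) (γ t)
      exact Metric.mem_ball.2 (by linarith)

/-- Homotopy invariance of analytic continuation. -/
theorem homotopy_invariant {S : Type*} [TopologicalSpace S] [PreconnectedSpace S] {h : S × I → E}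
    (hh : Continuous h) {x y : E} (h0 : ∀ s, h (s, 0) = x) (h1 : ∀ s, h (s, 1) = y)
    {Φ : S → I → E → ℂ} (hΦ : ∀ s, IsAnalyticContinuation f (fun t => h (s, t)) (Φ s)) (s s' : S) :
    Φ s 1 =ᶠ[𝓝 y] Φ s' 1 := by
  have hc : ∀ s, Continuous fun t => h (s, t) := fun s => by fun_prop
  -- The terminal germ at the fixed endpoint `y` is a locally constant function of the homotopy
  -- parameter.
  have hloc : IsLocallyConstant fun s => (Φ s 1 : Filter.Germ (𝓝 y) ℂ) := by
    rw [IsLocallyConstant.iff_eventually_eq]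
    intro s
    obtain ⟨ρ, hρ, hp⟩ := (hΦ s).exists_perturbation (hc s)
    have hnear : ∀ᶠ s' in 𝓝 s, ∀ t ∈ (Set.univ : Set I), dist (h (s', t)) (h (s, t)) < ρ := by
      refine isCompact_univ.eventually_forall_of_forall_eventually fun t _ => ?_
      have hd : Continuous fun z : S × I => dist (h (z.1, z.2)) (h (s, z.2)) := by fun_prop
      exact hd.continuousAt.eventually (gt_mem_nhds (by simpa using hρ))
    filter_upwards [hnear] with s' hs'
    obtain ⟨G, hG, hG1⟩ := hp _ (hc s') (by rw [h0, h0]) fun t => hs' t (Set.mem_univ t)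
    have := (hΦ s').unique (hc s') hG 1
    simp only [h1] at this hG1
    exact Filter.Germ.coe_eq.2 (this.trans hG1)
  exact Filter.Germ.coe_eq.1 (hloc.apply_eq_of_preconnectedSpace s s')

end IsAnalyticContinuation

end TracialFree

namespace TracialFree

variable {d : ℕ}

/-! ### Direct sums and rotations -/

/-- The direct sum of tuples as a continuous linear map. -/
noncomputable def directSumL (d m n : ℕ) : MatTuple d m × MatTuple d n →L[ℂ] MatTuple d (m + n) :=
  LinearMap.toContinuousLinearMap
    { toFun := fun p => directSum p.1 p.2
      map_add' := fun p q => by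
        funext c; ext i j
        simp only [directSum, Matrix.reindex_apply, Matrix.submatrix_apply, Pi.add_apply,
          Matrix.add_apply, Prod.fst_add, Prod.snd_add]
        rcases finSumFinEquiv.symm i with i | i <;> rcases finSumFinEquiv.symm j with j | j <;> simp
      map_smul' := fun a p => by
        funext c; ext i j
        simp only [directSum, Matrix.reindex_apply, Matrix.submatrix_apply, Pi.smul_apply,
          Matrix.smul_apply, Prod.smul_fst, Prod.smul_snd, RingHom.id_apply]
        rcases finSumFinEquiv.symm i with i | i <;> rcases finSumFinEquiv.symm j with j | j <;> simp }

@[simp] theorem directSumL_apply {m n : ℕ} (p : MatTuple d m × MatTuple d n) :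
    directSumL d m n p = directSum p.1 p.2 := rfl

theorem continuous_directSum {S : Type*} [TopologicalSpace S] {m n : ℕ} {γ : S → MatTuple d m}
    {δ : S → MatTuple d n} (hγ : Continuous γ) (hδ : Continuous δ) :
    Continuous fun s => directSum (γ s) (δ s) :=
  (directSumL d m n).continuous.comp (hγ.prodMk hδ)

/-- The unitary `2 × 2` block matrix rotating by the angle `θ`. -/
noncomputable def rotation (n : ℕ) (θ : ℝ) : Matrix (Fin (n + n)) (Fin (n + n)) ℂ :=
  Matrix.reindex finSumFinEquiv finSumFinEquiv
    (Matrix.fromBlocks ((Real.cos θ : ℂ) • 1) ((Real.sin θ : ℂ) • 1) (-(Real.sin θ : ℂ) • 1)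
      ((Real.cos θ : ℂ) • 1))

theorem star_rotation (n : ℕ) (θ : ℝ) : star (rotation n θ) = rotation n (-θ) := by
  simp only [rotation, Matrix.star_eq_conjTranspose, Matrix.conjTranspose_reindex,
    Matrix.fromBlocks_conjTranspose, Matrix.conjTranspose_smul, Matrix.conjTranspose_one,
    Real.cos_neg, Real.sin_neg]
  simp only [star_neg, Complex.star_def, Complex.conj_ofReal, Complex.ofReal_neg, neg_neg]

theorem rotation_zero (n : ℕ) : rotation n 0 = 1 := by
  simp [rotation]

/-- The off-diagonal blocks carry the factor `cos θ sin θ (X - Y)`: they vanish when `X = Y`, and at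
`θ = π / 2`, where the summands are exchanged. -/
theorem conj_rotation_directSum {n : ℕ} (θ : ℝ) (X Y : MatTuple d n) (c : Fin d) :
    conj (rotation n θ) (directSum X Y) c =
      Matrix.reindex finSumFinEquiv finSumFinEquiv (Matrix.fromBlocks
        ((Real.cos θ ^ 2 : ℂ) • X c + (Real.sin θ ^ 2 : ℂ) • Y c)
        ((Real.cos θ * Real.sin θ : ℂ) • (X c - Y c))
        ((Real.cos θ * Real.sin θ : ℂ) • (X c - Y c))
        ((Real.sin θ ^ 2 : ℂ) • X c + (Real.cos θ ^ 2 : ℂ) • Y c)) := by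
  rw [conj, star_rotation]
  simp only [rotation, directSum, Matrix.reindex_apply,
    Matrix.submatrix_mul_equiv, Matrix.fromBlocks_multiply, Real.cos_neg, Real.sin_neg,
    Complex.ofReal_neg]
  congr 2 <;> simp [smul_smul] <;> module

theorem rotation_mem_unitaryGroup (n : ℕ) (θ : ℝ) :
    rotation n θ ∈ Matrix.unitaryGroup (Fin (n + n)) ℂ := by
  have h : (Real.cos θ : ℂ) ^ 2 + (Real.sin θ : ℂ) ^ 2 = 1 := by
    exact_mod_cast Real.cos_sq_add_sin_sq θ
  rw [Matrix.mem_unitaryGroup_iff', star_rotation]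
  simp only [rotation, Matrix.reindex_apply, Matrix.submatrix_mul_equiv, Matrix.fromBlocks_multiply,
    Real.cos_neg, Real.sin_neg, Complex.ofReal_neg]
  rw [← Matrix.submatrix_one_equiv finSumFinEquiv.symm, ← Matrix.fromBlocks_one]
  congr 2
  · simp only [smul_mul_smul_comm, mul_one, ← add_smul]
    rw [show (Real.cos θ : ℂ) * Real.cos θ + -Real.sin θ * -Real.sin θ = 1 by rw [← h]; ring,
      one_smul]
  · simp only [smul_mul_smul_comm, mul_one, ← add_smul]
    rw [show (Real.cos θ : ℂ) * Real.sin θ + -Real.sin θ * Real.cos θ = 0 by ring, zero_smul]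
  · simp only [smul_mul_smul_comm, mul_one, ← add_smul]
    rw [show - -(Real.sin θ : ℂ) * Real.cos θ + Real.cos θ * -Real.sin θ = 0 by ring, zero_smul]
  · simp only [smul_mul_smul_comm, mul_one, ← add_smul]
    rw [show - -(Real.sin θ : ℂ) * Real.sin θ + Real.cos θ * Real.cos θ = 1 by rw [← h]; ring,
      one_smul]

theorem conj_rotation_self {n : ℕ} (θ : ℝ) (X : MatTuple d n) :
    conj (rotation n θ) (directSum X X) = directSum X X := by
  have h : (Real.cos θ : ℂ) ^ 2 + (Real.sin θ : ℂ) ^ 2 = 1 := by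
    exact_mod_cast Real.cos_sq_add_sin_sq θ
  funext c
  rw [conj_rotation_directSum, ← add_smul, ← add_smul, add_comm ((Real.sin θ : ℂ) ^ 2), h]
  simp [directSum]

theorem conj_rotation_zero {n : ℕ} (X Y : MatTuple d n) :
    conj (rotation n 0) (directSum X Y) = directSum X Y := by
  funext c
  simp [conj, rotation_zero]

theorem conj_rotation_pi_div_two {n : ℕ} (X Y : MatTuple d n) :
    conj (rotation n (Real.pi / 2)) (directSum X Y) = directSum Y X := by
  funext c
  rw [conj_rotation_directSum]
  simp [directSum]

theorem continuous_rotation (n : ℕ) : Continuous fun θ : ℝ => rotation n θ := by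
  unfold rotation
  refine Continuous.matrix_reindex ?_ _ _
  refine Continuous.matrix_fromBlocks ?_ ?_ ?_ ?_ <;> fun_prop

theorem continuous_conj {S : Type*} [TopologicalSpace S] {n : ℕ}
    {U : S → Matrix (Fin n) (Fin n) ℂ} {γ : S → MatTuple d n} (hU : Continuous U)
    (hγ : Continuous γ) : Continuous fun s => conj (U s) (γ s) := by
  refine continuous_pi fun c => ?_
  have h : Continuous fun s => γ s c := (continuous_apply c).comp hγ
  exact (hU.star.matrix_mul h).matrix_mul hU

theorem continuous_conj_rotation_directSum {S : Type*} [TopologicalSpace S] {n : ℕ}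
    {γ : S → MatTuple d n} (hγ : Continuous γ) (y : MatTuple d n) :
    Continuous fun p : ℝ × S => conj (rotation n p.1) (directSum (γ p.2) y) := by
  have h1 : Continuous fun p : ℝ × S => γ p.2 := hγ.comp continuous_snd
  have h2 : Continuous fun p : ℝ × S => directSum (γ p.2) y :=
    continuous_directSum h1 continuous_const
  have h3 : Continuous fun p : ℝ × S => rotation n p.1 :=
    (continuous_rotation n).comp continuous_fst
  exact continuous_conj h3 h2

/-! ### Continuation of global germs -/

namespace IsGlobalGerm

variable {D B : FreeSet d} {f : ∀ n : ℕ, MatTuple d n → ℂ}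

theorem exists_continuation (hf : IsGlobalGerm D B f) {n : ℕ} {γ : I → MatTuple d n}
    (hγ : Continuous γ) (h0 : γ 0 ∈ B.level n) (hD : ∀ t, γ t ∈ D.level n) :
    ∃ F, IsAnalyticContinuation (f n) γ F :=
  hf.continues (x := γ 0) (y := γ 1) ⟨⟨γ, hγ⟩, rfl, rfl⟩ h0 hD

theorem analyticAt (hf : IsGlobalGerm D B f) (hBD : ∀ n, B.level n ⊆ D.level n) {n : ℕ}
    {x : MatTuple d n} (hx : x ∈ B.level n) : AnalyticAt ℂ (f n) x := by
  obtain ⟨F, hF⟩ := hf.exists_continuation (γ := fun _ => x) continuous_const hx fun _ => hBD n hx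
  exact (hF.analyticAt 0).congr hF.initial

theorem continuation_const (hf : IsGlobalGerm D B f) (hBD : ∀ n, B.level n ⊆ D.level n) {n : ℕ}
    {x : MatTuple d n} (hx : x ∈ B.level n) :
    IsAnalyticContinuation (f n) (fun _ => x) (fun _ => f n) :=
  .of_analyticAt fun _ => hf.analyticAt hBD hx

/-- The continuation of a global germ along a direct sum of paths is the sum of the continuations. -/
theorem continuation_directSum (hf : IsGlobalGerm D B f) (hB : B.IsOpen) {m n : ℕ}
    {γ : I → MatTuple d m} {δ : I → MatTuple d n} (hγ : Continuous γ) (hδ : Continuous δ)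
    (hγ0 : γ 0 ∈ B.level m) (hδ0 : δ 0 ∈ B.level n) {F : I → MatTuple d m → ℂ}
    {G : I → MatTuple d n → ℂ} {H : I → MatTuple d (m + n) → ℂ}
    (hF : IsAnalyticContinuation (f m) γ F) (hG : IsAnalyticContinuation (f n) δ G)
    (hH : IsAnalyticContinuation (f (m + n)) (fun t => directSum (γ t) (δ t)) H) (t : I) :
    ∀ᶠ p in 𝓝 (γ t, δ t), H t (directSum p.1 p.2) = F t p.1 + G t p.2 := by
  -- On the product space both sides continue the same germ, by additivity of `f` on `B`, so
  -- uniqueness applies.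
  have h1 := hH.comp_clm (directSumL d m n) (γ := fun t => (γ t, δ t))
  have h2 := hF.comp_clm (ContinuousLinearMap.fst ℂ _ _) (γ := fun t => (γ t, δ t))
  have h3 := hG.comp_clm (ContinuousLinearMap.snd ℂ _ _) (γ := fun t => (γ t, δ t))
  have h4 := h2.add h3
  have h0 : (fun p : MatTuple d m × MatTuple d n => f (m + n) (directSumL d m n p))
      =ᶠ[𝓝 (γ 0, δ 0)] fun p => f m p.1 + f n p.2 := by
    have ho := ((hB m).prod (hB n)).mem_nhds (Set.mk_mem_prod hγ0 hδ0)
    exact Filter.mem_of_superset ho fun p hp => hf.isTracialFree.map_directSum hp.1 hp.2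
  have h5 := h1.congr_initial h0
  have h6 := h5.unique (hγ.prodMk hδ) h4 t
  exact h6

/-- Continuing a global germ along a loop only adds a constant. -/
theorem continuation_loop (hf : IsGlobalGerm D B f) (hBD : ∀ n, B.level n ⊆ D.level n)
    (hB : B.IsOpen) {n : ℕ} {γ : I → MatTuple d n} (hγ : Continuous γ) (h0 : γ 0 ∈ B.level n)
    (h1 : γ 1 = γ 0) (hD : ∀ t, γ t ∈ D.level n) {F : I → MatTuple d n → ℂ}
    (hF : IsAnalyticContinuation (f n) γ F) :
    ∀ᶠ z in 𝓝 (γ 0), F 1 z = f n z + (F 1 (γ 0) - f n (γ 0)) := by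
  obtain ⟨y, hy⟩ : ∃ y, γ 0 = y := ⟨_, rfl⟩
  rw [hy] at h0 h1 ⊢
  -- Rotations fix `y ⊕ y`, so every path of this homotopy is a loop at `y ⊕ y`; angle `0` gives `γ
  -- ⊕ y` and angle `π / 2` gives `y ⊕ γ`.
  let h : ℝ × I → MatTuple d (n + n) := fun p => conj (rotation n p.1) (directSum (γ p.2) y)
  have hh : Continuous h := continuous_conj_rotation_directSum hγ y
  have hh0 : ∀ θ, h (θ, 0) = directSum y y := fun θ => by
    simp only [h, hy, conj_rotation_self]
  have hh1 : ∀ θ, h (θ, 1) = directSum y y := fun θ => by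
    simp only [h, h1, conj_rotation_self]
  have hmem : ∀ p, h p ∈ D.level (n + n) := fun p =>
    D.conj_mem (D.directSum_mem (hD _) (hBD n h0)) (rotation_mem_unitaryGroup n p.1)
  have hex : ∀ θ : ℝ, ∃ Φ, IsAnalyticContinuation (f (n + n)) (fun t => h (θ, t)) Φ := fun θ =>
    hf.exists_continuation (hh.comp (continuous_const.prodMk continuous_id))
      (by rw [hh0]; exact B.directSum_mem h0 h0) fun t => hmem _
  choose Φ hΦ using hex
  have hinv := IsAnalyticContinuation.homotopy_invariant hh hh0 hh1 hΦ 0 (Real.pi / 2)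
  have hA := hΦ 0
  have hC := hΦ (Real.pi / 2)
  simp only [h, conj_rotation_zero] at hA
  simp only [h, conj_rotation_pi_div_two] at hC
  have hconst := hf.continuation_const hBD h0
  have eA := hf.continuation_directSum hB hγ continuous_const (hy ▸ h0) h0 hF hconst hA 1
  have eC := hf.continuation_directSum hB continuous_const hγ h0 (hy ▸ h0) hconst hF hC 1
  rw [h1] at eA eC
  have hS : ∀ᶠ z in 𝓝 y, Φ 0 1 (directSum z y) = Φ (Real.pi / 2) 1 (directSum z y) :=
    (continuous_directSum continuous_id continuous_const).continuousAt.eventually hinv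
  have hpair : Continuous fun z : MatTuple d n => (z, y) := by fun_prop
  filter_upwards [hS, hpair.continuousAt.eventually eA, hpair.continuousAt.eventually eC]
    with z h2 h3 h4
  linear_combination h2 - h3 + h4

end IsGlobalGerm

end TracialFree

/-! ### Continuation along concatenations and amplifications -/

namespace TracialFree

variable {d : ℕ}

/-- An analytic continuation along a concatenation consists of continuations along the two parts. -/
theorem IsAnalyticContinuation.of_trans {E : Type*} [NormedAddCommGroup E] [NormedSpace ℂ E]
    {f : E → ℂ} {a b c : E} {p : Path a b} {q : Path b c} {H : I → E → ℂ}
    (hH : IsAnalyticContinuation f (p.trans q) H) :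
    ∃ F G, IsAnalyticContinuation f p F ∧ IsAnalyticContinuation (F 1) q G ∧ G 1 = H 1 := by
  let φ : I → I := fun t => ⟨t / 2, by constructor <;> linarith [t.2.1, t.2.2]⟩
  let ψ : I → I := fun t => ⟨(1 + t) / 2, by constructor <;> linarith [t.2.1, t.2.2]⟩
  have hφ : Continuous φ := by fun_prop
  have hψ : Continuous ψ := by fun_prop
  have eφ : (fun t => (p.trans q) (φ t)) = p := by
    funext t
    have ht : ((φ t : I) : ℝ) ≤ 1 / 2 := by
      have := t.2.2
      simp only [φ]; linarith
    rw [Path.trans_apply, dif_pos ht]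
    congr 1; ext
    simp only [φ]; ring
  have eψ : (fun t => (p.trans q) (ψ t)) = q := by
    funext t
    -- Reversal moves the second half into the first branch of `Path.trans_apply`, which also takes
    -- care of the midpoint.
    have e : (p.trans q).symm (σ (ψ t)) = (p.trans q) (ψ t) := by
      change (p.trans q) (σ (σ (ψ t))) = _
      rw [unitInterval.symm_symm]
    have hσ : ((σ (ψ t) : I) : ℝ) ≤ 1 / 2 := by
      have := t.2.1
      simp only [ψ, unitInterval.coe_symm_eq]; linarith
    rw [← e, Path.trans_symm, Path.trans_apply, dif_pos hσ]
    change q (σ _) = q t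
    congr 1; ext
    simp only [ψ, unitInterval.coe_symm_eq]; ring
  have h1 := hH.reparam hφ
  have h2 := hH.reparam hψ
  have φ0 : φ 0 = 0 := by ext; simp [φ]
  have φ1 : ψ 0 = φ 1 := by ext; simp [φ, ψ]
  have ψ1 : ψ 1 = 1 := by ext; simp [ψ]
  rw [eφ, φ0] at h1
  rw [eψ, φ1] at h2
  refine ⟨_, _, h1.congr_initial ?_, h2, by rw [ψ1]⟩
  simpa using hH.initial

namespace IsGlobalGerm

variable {D B : FreeSet d} {f : ∀ n : ℕ, MatTuple d n → ℂ}

theorem continuation_ampl (hf : IsGlobalGerm D B f) (hB : B.IsOpen) {k n N : ℕ} (hk : 0 < k)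
    (h : k * n = N) {γ : I → MatTuple d n} (hγ : Continuous γ) (h0 : γ 0 ∈ B.level n)
    (hD : ∀ t, γ t ∈ D.level n) {F : I → MatTuple d n → ℂ} {H : I → MatTuple d N → ℂ}
    (hF : IsAnalyticContinuation (f n) γ F)
    (hH : IsAnalyticContinuation (f N) (fun t => ampl k h (γ t)) H) :
    H 1 (ampl k h (γ 1)) = k * F 1 (γ 1) := by
  induction k, hk using Nat.le_induction generalizing N with
  | base =>
    obtain rfl : n = N := by omega
    simp only [ampl_one] at hH ⊢
    have h1 := (hH.unique hγ hF 1).eq_of_nhds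
    rw [h1]
    simp
  | succ k hk ih =>
    obtain rfl : k * n + n = N := by rw [← h]; ring
    have hc : Continuous fun t => ampl k rfl (γ t) := (continuous_ampl rfl).comp hγ
    have hk0 : ampl k rfl (γ 0) ∈ B.level (k * n) := B.ampl_mem rfl hk h0
    obtain ⟨G, hG⟩ := hf.exists_continuation hc hk0 fun t => D.ampl_mem rfl hk (hD t)
    simp only [ampl_succ rfl h] at hH ⊢
    have h1 := (hf.continuation_directSum hB hc hγ hk0 h0 hG hF hH 1).self_of_nhds
    simp only at h1
    rw [h1, ih rfl hG]
    push_cast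
    ring

theorem map_ampl (hf : IsGlobalGerm D B f) (hBD : ∀ n, B.level n ⊆ D.level n) (hB : B.IsOpen)
    {k n N : ℕ} (hk : 0 < k) (h : k * n = N) {x : MatTuple d n} (hx : x ∈ B.level n) :
    f N (ampl k h x) = k * f n x :=
  hf.continuation_ampl hB hk h (γ := fun _ => x) continuous_const hx (fun _ => hBD n hx)
    (hf.continuation_const hBD hx) (hf.continuation_const hBD (B.ampl_mem h hk hx))

end IsGlobalGerm

/-! ### The monodromy homomorphism -/

namespace EssPath

variable {D B : FreeSet d} {n p : ℕ} {X : MatTuple d n} {Z : MatTuple d p}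
  {f : ∀ n : ℕ, MatTuple d n → ℂ}

theorem exists_continuation (γ : EssPath D X Z) (hf : IsGlobalGerm D B f) (hX : X ∈ B.level n) :
    ∃ F, IsAnalyticContinuation (f γ.size) γ.path F :=
  hf.continues γ.path (B.ampl_mem _ γ.k_pos hX) γ.mem

theorem l_eq_k (γ : EssPath D X X) (hn : 0 < n) : γ.l = γ.k :=
  Nat.eq_of_mul_eq_mul_right hn (γ.target_size.trans γ.source_size.symm)

/-- The first leg changes `f` by the constant `c = k₂ k₁ (f(γ₁) - f(X))`, by `continuation_loop`,
since `l₁ = k₁`. The second leg carries `c` along unchanged and ends at `l₁ l₂ f(γ₂) + c`; dividing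
by `l₁ l₂` gives the formula. -/
theorem value_comp (hBD : ∀ n, B.level n ⊆ D.level n) (hB : B.IsOpen) (hX : X ∈ B.level n)
    (hn : 0 < n) (γ₂ : EssPath D X Z) (γ₁ : EssPath D X X) (hf : IsGlobalGerm D B f) :
    (γ₂.comp γ₁).value f = γ₂.value f + γ₂.k / γ₂.l * (γ₁.value f - f n X) := by
  obtain ⟨H, hH⟩ := (γ₂.comp γ₁).exists_continuation hf hX
  obtain ⟨F₁, hF₁⟩ := γ₁.exists_continuation hf hX
  obtain ⟨F₂, hF₂⟩ := γ₂.exists_continuation hf hX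
  rw [value_eq hH, value_eq hF₁, value_eq hF₂]
  have hlk := γ₁.l_eq_k hn
  have hc₁ : Continuous fun t => ampl γ₂.k rfl (γ₁.path t) :=
    (continuous_ampl rfl).comp γ₁.path.continuous
  have hc₂ : Continuous fun t => ampl γ₁.l (comp_size γ₂ γ₁) (γ₂.path t) :=
    (continuous_ampl _).comp γ₂.path.continuous
  have hB₁ : γ₁.path 0 ∈ B.level _ := by
    rw [γ₁.path.source]; exact B.ampl_mem _ γ₁.k_pos hX
  have hB₂ : γ₂.path 0 ∈ B.level _ := by
    rw [γ₂.path.source]; exact B.ampl_mem _ γ₂.k_pos hX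
  have hB₁' : ampl γ₂.k rfl (γ₁.path 0) ∈ B.level _ := B.ampl_mem rfl γ₂.k_pos hB₁
  have hB₂' : ampl γ₁.l (comp_size γ₂ γ₁) (γ₂.path 0) ∈ B.level _ := B.ampl_mem _ γ₁.l_pos hB₂
  have hclosed : γ₁.path 1 = γ₁.path 0 := by
    rw [γ₁.path.target, γ₁.path.source]
    congr 1
  obtain ⟨F, G, hF, hG, hGH⟩ := IsAnalyticContinuation.of_trans
    (p := (γ₁.path.map (continuous_ampl rfl)).cast (ampl_ampl _ _ _ _).symm rfl)
    (q := (γ₂.path.map (continuous_ampl (comp_size γ₂ γ₁))).cast (comp_middle γ₂ γ₁)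
      (ampl_ampl _ _ _ _).symm) hH
  have hF' : IsAnalyticContinuation (f (γ₂.k * γ₁.size)) (fun t => ampl γ₂.k rfl (γ₁.path t)) F := hF
  have hG' : IsAnalyticContinuation (F 1)
    (fun t => ampl γ₁.l (comp_size γ₂ γ₁) (γ₂.path t)) G := hG
  have hloop := hf.continuation_loop hBD hB hc₁ hB₁' (by rw [hclosed])
    (fun t => D.ampl_mem rfl γ₂.k_pos (γ₁.mem t)) hF'
  have hval₁ := hf.continuation_ampl hB γ₂.k_pos rfl γ₁.path.continuous hB₁ γ₁.mem hF₁ hF'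
  obtain ⟨K, hK⟩ := hf.exists_continuation hc₂ hB₂' fun t => D.ampl_mem _ γ₁.l_pos (γ₂.mem t)
  have hval₂ := hf.continuation_ampl hB γ₁.l_pos _ γ₂.path.continuous hB₂ γ₂.mem hF₂ hK
  -- The base point of the first leg is the starting point of the second, so the germ `f + c` there
  -- can be continued along the second leg.
  have hmid : ampl γ₂.k rfl (γ₁.path 0) = ampl γ₁.l (comp_size γ₂ γ₁) (γ₂.path 0) := by
    rw [← hclosed, γ₁.path.target, γ₂.path.source, comp_middle]
  have hf₁ : f _ (ampl γ₂.k rfl (γ₁.path 0)) = γ₂.k * (γ₁.k * f n X) := by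
    rw [hf.map_ampl hBD hB γ₂.k_pos rfl hB₁, γ₁.path.source, hf.map_ampl hBD hB γ₁.k_pos _ hX]
  have hF₁e : F 1 (ampl γ₂.k rfl (γ₁.path 0)) = γ₂.k * F₁ 1 (ampl γ₁.l γ₁.target_size X) := by
    rw [← hclosed, hval₁, γ₁.path.target]
  rw [hF₁e, hf₁, hmid] at hloop
  have hKc := hK.add (.of_analyticAt fun _ => analyticAt_const
    (v := (γ₂.k * F₁ 1 (ampl γ₁.l γ₁.target_size X) - γ₂.k * (γ₁.k * f n X) : ℂ)))
  have hend := ((hG'.congr_initial hloop).unique hc₂ hKc 1).eq_of_nhds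
  simp only [γ₂.path.target] at hend hval₂
  rw [hval₂] at hend
  have hHend : H 1 (ampl (γ₂.comp γ₁).l (γ₂.comp γ₁).target_size Z) =
      G 1 (ampl γ₁.l (comp_size γ₂ γ₁) (ampl γ₂.l γ₂.target_size Z)) := by
    rw [hGH]
    exact congrArg (H 1) (ampl_ampl _ _ (γ₂.comp γ₁).target_size Z).symm
  rw [hHend, hend]
  have h1 : (γ₁.k : ℂ) ≠ 0 := Nat.cast_ne_zero.2 γ₁.k_pos.ne'
  have h2 : (γ₂.l : ℂ) ≠ 0 := Nat.cast_ne_zero.2 γ₂.l_pos.ne'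
  simp only [comp, hlk]
  push_cast
  field_simp

/-- The trace of the monodromy along a loop: the average increment of a global germ. -/
noncomputable def monodromy (B : FreeSet d) (γ : EssPath D X X)
    (f : {f : ∀ n : ℕ, MatTuple d n → ℂ // IsGlobalGerm D B f}) : ℂ :=
  γ.value f.1 - f.1 n X

theorem monodromy_comp (hBD : ∀ n, B.level n ⊆ D.level n) (hB : B.IsOpen) (hX : X ∈ B.level n)
    (hn : 0 < n) (γ₂ γ₁ : EssPath D X X) :
    monodromy B (γ₂.comp γ₁) = monodromy B γ₂ + monodromy B γ₁ := by
  funext f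
  have h2 : (γ₂.k : ℂ) ≠ 0 := Nat.cast_ne_zero.2 γ₂.k_pos.ne'
  simp only [monodromy, Pi.add_apply]
  rw [value_comp hBD hB hX hn γ₂ γ₁ f.2, γ₂.l_eq_k hn, div_self h2]
  ring

theorem monodromy_refl (hBD : ∀ n, B.level n ⊆ D.level n) (hX : X ∈ B.level n) :
    monodromy B (refl (D := D) X (hBD n hX)) = 0 := by
  funext f
  have h1 : ampl 1 (Nat.one_mul n) X = X := ampl_one _ _
  have h := f.2.continuation_const hBD (B.ampl_mem (Nat.one_mul n) one_pos hX)
  have hv := value_eq (γ := refl (D := D) X (hBD n hX)) (f := f.1) (F := fun _ => f.1 n) h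
  simp only [monodromy, Pi.zero_apply, hv]
  simp [refl, h1]

/-- The trivial path as `γ₃` recovers the monodromy; conversely, by `value_comp`, a further path
sees a loop only through its monodromy. -/
theorem traceEquiv_iff (hBD : ∀ n, B.level n ⊆ D.level n) (hB : B.IsOpen) (hX : X ∈ B.level n)
    (hn : 0 < n) (γ₁ γ₂ : EssPath D X X) :
    TraceEquiv B γ₁ γ₂ ↔ monodromy B γ₁ = monodromy B γ₂ := by
  constructor
  · intro h
    funext f
    have h1 := h f.1 f.2 n X (hBD n hX) (refl X (hBD n hX))
    rw [value_comp hBD hB hX hn _ _ f.2, value_comp hBD hB hX hn _ _ f.2] at h1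
    simp only [refl, Nat.cast_one, div_one, one_mul] at h1
    exact add_left_cancel h1
  · intro h f hf p Z _ γ₃
    have h1 := congrFun h ⟨f, hf⟩
    simp only [monodromy] at h1
    rw [value_comp hBD hB hX hn _ _ hf, value_comp hBD hB hX hn _ _ hf, h1]

theorem monodromy_symm (hBD : ∀ n, B.level n ⊆ D.level n) (hB : B.IsOpen) (hX : X ∈ B.level n)
    (hn : 0 < n) (γ : EssPath D X X) : monodromy B γ.symm = -monodromy B γ := by
  funext f
  obtain ⟨F, hF⟩ := γ.exists_continuation f.2 hX
  have hlk := γ.l_eq_k hn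
  have hX0 : γ.path 0 = ampl γ.l γ.target_size X := by
    rw [γ.path.source]
    congr 1
    exact hlk.symm
  have hX1 : γ.path 1 = γ.path 0 := by rw [hX0, γ.path.target]
  have hXB : γ.path 0 ∈ B.level _ := by rw [γ.path.source]; exact B.ampl_mem _ γ.k_pos hX
  have hloop := f.2.continuation_loop hBD hB γ.path.continuous hXB hX1 γ.mem hF
  set c := F 1 (γ.path 0) - f.1 γ.size (γ.path 0) with hc
  -- Since `F 1 = f + c` near the base point, `F (σ t) - c` continues `f` along the reversed path.
  have hr := (hF.reparam unitInterval.continuous_symm).add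
    (.of_analyticAt fun _ => analyticAt_const (v := -c))
  rw [unitInterval.symm_zero] at hr
  have hi : ∀ᶠ z in 𝓝 (γ.path (σ 0)), F 1 z + -c = f.1 γ.size z := by
    rw [unitInterval.symm_zero, hX1]
    filter_upwards [hloop] with z hz
    rw [hz]; ring
  have hs : IsAnalyticContinuation (f.1 γ.symm.size) γ.symm.path _ := hr.congr_initial hi
  have h0 := hF.initial.eq_of_nhds
  have hfX : f.1 γ.size (γ.path 0) = γ.l * f.1 n X := by
    rw [hX0, f.2.map_ampl hBD hB γ.l_pos _ hX]
  have hl : (γ.l : ℂ) ≠ 0 := Nat.cast_ne_zero.2 γ.l_pos.ne'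
  simp only [monodromy, Pi.neg_apply]
  rw [value_eq hs, value_eq hF]
  have e : ampl γ.symm.l γ.symm.target_size X = γ.path 0 := γ.path.source.symm
  have e1 : F 1 (ampl γ.l γ.target_size X) = F 1 (γ.path 0) := congrArg (F 1) hX0.symm
  rw [e, e1, unitInterval.symm_one, h0]
  rw [hfX] at hc ⊢
  rw [hc]
  simp only [symm, ← hlk]
  field_simp
  ring

/-- Adding a constant block to a loop does not change the total increment of a global germ. -/
theorem exists_monodromy_div (hBD : ∀ n, B.level n ⊆ D.level n) (hB : B.IsOpen)
    (hX : X ∈ B.level n) (γ : EssPath D X X) (j : ℕ) :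
    ∃ δ : EssPath D X X, δ.l = γ.l + j ∧ ∀ f, δ.l * monodromy B δ f = γ.l * monodromy B γ f := by
  induction j with
  | zero => exact ⟨γ, rfl, fun _ => rfl⟩
  | succ j ih =>
    obtain ⟨δ, hδ, h⟩ := ih
    have hk : (δ.k + 1) * n = δ.size + n := by rw [add_mul, one_mul, δ.source_size]
    have hl : (δ.l + 1) * n = δ.size + n := by rw [add_mul, one_mul, δ.target_size]
    have hc : Continuous fun t => directSum (δ.path t) X :=
      continuous_directSum δ.path.continuous continuous_const
    -- The loop `δ ⊕ X`: the constant summand adds `f X` to the value of the continuation at both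
    -- ends.
    let ε : EssPath D X X :=
      { size := δ.size + n
        k := δ.k + 1
        l := δ.l + 1
        k_pos := Nat.succ_pos _
        l_pos := Nat.succ_pos _
        source_size := hk
        target_size := hl
        path := ⟨⟨fun t => directSum (δ.path t) X, hc⟩,
          by simp only [ampl_succ δ.source_size hk, δ.path.source],
          by simp only [ampl_succ δ.target_size hl, δ.path.target]⟩
        mem := fun t => D.directSum_mem (δ.mem t) (hBD n hX) }
    refine ⟨ε, by simp only [ε, hδ, add_assoc], fun f => ?_⟩
    rw [← h f]
    obtain ⟨F, hF⟩ := δ.exists_continuation f.2 hX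
    obtain ⟨H, hH⟩ := ε.exists_continuation f.2 hX
    have h0 : δ.path 0 ∈ B.level _ := by rw [δ.path.source]; exact B.ampl_mem _ δ.k_pos hX
    have hsum := (f.2.continuation_directSum hB δ.path.continuous continuous_const h0 hX hF
      (f.2.continuation_const hBD hX) hH 1).self_of_nhds
    simp only [δ.path.target] at hsum
    have hH1 : H 1 (ampl ε.l ε.target_size X) =
        F 1 (ampl δ.l δ.target_size X) + f.1 n X := by
      rw [← hsum]
      exact congrArg (H 1) (ampl_succ δ.target_size hl X)
    simp only [monodromy]
    rw [value_eq hH, value_eq hF, hH1]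
    have e1 : (δ.l : ℂ) ≠ 0 := Nat.cast_ne_zero.2 δ.l_pos.ne'
    have e2 : (ε.l : ℂ) ≠ 0 := Nat.cast_ne_zero.2 ε.l_pos.ne'
    have e3 : (ε.l : ℂ) = δ.l + 1 := by simp [ε]
    field_simp
    rw [e3]
    ring

end EssPath

end TracialFree

/-! ### Countability and the rational vector space of monodromies -/

namespace TracialFree

variable {d : ℕ}

namespace EssPath

variable {D B : FreeSet d} {n : ℕ} {X : MatTuple d n}

/-- The paths in `D` from `X^{⊕k}` to `X^{⊕l}`. -/
abbrev PathIn (D : FreeSet d) (X : MatTuple d n) {k l N : ℕ} (h : k * n = N) (h' : l * n = N) :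
    Type :=
  {q : Path (ampl k h X) (ampl l h' X) // ∀ t, q t ∈ D.level N}

/-- A path in `D` from `X^{⊕k}` to `X^{⊕l}`, as a path essentially taking `X` to `X`. -/
def PathIn.toEssPath {k l N : ℕ} {h : k * n = N} {h' : l * n = N} (hk : 0 < k) (hl : 0 < l)
    (q : PathIn D X h h') : EssPath D X X :=
  ⟨N, k, l, hk, hl, h, h', q.1, q.2⟩

/-- Uniformly close paths have the same monodromy. -/
theorem eventually_monodromy_eq (hD : D.IsOpen) (hX : X ∈ B.level n) {k l N : ℕ} {h : k * n = N}
    {h' : l * n = N} (hk : 0 < k) (hl : 0 < l) (q : PathIn D X h h') :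
    ∀ᶠ r in 𝓝 q, monodromy B (PathIn.toEssPath hk hl r) = monodromy B (q.toEssPath hk hl) := by
  -- A `ρ`-neighbourhood of the image of `q` lies in `D`, so the straight-line homotopy from `q` to
  -- a path within `ρ` of it stays in `D`.
  obtain ⟨ρ, hρ, hsub⟩ := (isCompact_range q.1.continuous).exists_thickening_subset_open (hD N)
    (Set.range_subset_iff.2 q.2)
  have hev : Continuous fun z : PathIn D X h h' × I => z.1.1 z.2 := by fun_prop
  have hnear : ∀ᶠ r in 𝓝 q, ∀ t ∈ (Set.univ : Set I), dist (r.1 t) (q.1 t) < ρ := by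
    refine isCompact_univ.eventually_forall_of_forall_eventually fun t _ => ?_
    have hd : Continuous fun z : PathIn D X h h' × I => dist (z.1.1 z.2) (q.1 z.2) := by fun_prop
    exact hd.continuousAt.eventually (gt_mem_nhds (by simpa using hρ))
  filter_upwards [hnear] with r hr
  funext f
  let H : I × I → MatTuple d N := fun z => AffineMap.lineMap (q.1 z.2) (r.1 z.2) (z.1 : ℝ)
  have hH : Continuous H := by
    simp only [H, AffineMap.lineMap_apply_module]
    fun_prop
  have hH0 : ∀ s, H (s, 0) = ampl k h X := fun s => by simp [H]
  have hH1 : ∀ s, H (s, 1) = ampl l h' X := fun s => by simp [H]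
  have hHD : ∀ z, H z ∈ D.level N := fun z => by
    refine hsub (Metric.mem_thickening_iff.2 ⟨q.1 z.2, Set.mem_range_self _, ?_⟩)
    exact (convex_ball (q.1 z.2) ρ).lineMap_mem (Metric.mem_ball_self hρ) (hr z.2 (Set.mem_univ _))
      z.1.2
  have hex : ∀ s : I, ∃ Φ, IsAnalyticContinuation (f.1 N) (fun t => H (s, t)) Φ := fun s =>
    f.2.exists_continuation (by fun_prop) (by rw [hH0]; exact B.ampl_mem h hk hX) fun t => hHD _
  choose Φ hΦ using hex
  have hinv := (IsAnalyticContinuation.homotopy_invariant hH hH0 hH1 hΦ 1 0).eq_of_nhds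
  have hq := hΦ 0
  have hr' := hΦ 1
  simp only [H, Set.Icc.coe_zero, Set.Icc.coe_one, AffineMap.lineMap_apply_zero,
    AffineMap.lineMap_apply_one] at hq hr'
  have vq := value_eq (γ := PathIn.toEssPath hk hl q) hq
  have vr := value_eq (γ := PathIn.toEssPath hk hl r) hr'
  simp only [monodromy]
  rw [vq, vr]
  exact congrArg (fun a => a / (l : ℂ) - f.1 n X) hinv

instance secondCountableTopology_pathIn {k l N : ℕ} (h : k * n = N) (h' : l * n = N) :
    SecondCountableTopology (PathIn D X h h') := by
  have h1 : SecondCountableTopology (Matrix (Fin N) (Fin N) ℂ) :=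
    inferInstanceAs (SecondCountableTopology (Fin N → Fin N → ℂ))
  have h2 : SecondCountableTopology C(I, MatTuple d N) := inferInstance
  have h3 : SecondCountableTopology (Path (ampl k h X) (ampl l h' X)) :=
    (Topology.IsInducing.mk rfl :
      Topology.IsInducing (Path.toContinuousMap (x := ampl k h X) (y := ampl l h' X))).secondCountableTopology
  exact TopologicalSpace.Subtype.secondCountableTopology _

/-- For fixed `k`, `l`, `N`, the Lindelöf property leaves countably many neighbourhoods, on each of
which the monodromy is constant. -/
theorem countable_range_monodromy (hD : D.IsOpen) (hX : X ∈ B.level n) :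
    (Set.range fun γ : EssPath D X X => monodromy B γ).Countable := by
  have key : ∀ (k l N : ℕ) (h : k * n = N) (h' : l * n = N) (hk : 0 < k) (hl : 0 < l),
      (Set.range fun q : PathIn D X h h' => monodromy B (q.toEssPath hk hl)).Countable := by
    intro k l N h h' hk hl
    obtain ⟨s, hs, hcov⟩ := TopologicalSpace.countable_cover_nhds
      fun q : PathIn D X h h' => eventually_monodromy_eq (B := B) hD hX hk hl q
    refine (hs.image fun q : PathIn D X h h' => monodromy B (q.toEssPath hk hl)).mono ?_
    rintro _ ⟨r, rfl⟩
    have hr : r ∈ ⋃ q ∈ s, {r : PathIn D X h h' |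
        monodromy B (r.toEssPath hk hl) = monodromy B (q.toEssPath hk hl)} := by
      rw [hcov]; exact Set.mem_univ r
    obtain ⟨q, hq, hqr⟩ := Set.mem_iUnion₂.1 hr
    exact ⟨q, hq, hqr.symm⟩
  refine (Set.countable_iUnion fun k => Set.countable_iUnion fun l => Set.countable_iUnion fun N =>
    Set.countable_iUnion fun h => Set.countable_iUnion fun h' => Set.countable_iUnion fun hk =>
    Set.countable_iUnion fun hl => key k l N h h' hk hl).mono ?_
  rintro _ ⟨γ, rfl⟩
  simp only [Set.mem_iUnion]
  exact ⟨γ.k, γ.l, γ.size, γ.source_size, γ.target_size, γ.k_pos, γ.l_pos, ⟨γ.path, γ.mem⟩, rfl⟩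

/-- The monodromies of the paths essentially taking `X` to `X` form a rational vector space. -/
noncomputable def monodromySubmodule (hBD : ∀ n, B.level n ⊆ D.level n) (hB : B.IsOpen)
    (hX : X ∈ B.level n) (hn : 0 < n) :
    Submodule ℚ ({f : ∀ n : ℕ, MatTuple d n → ℂ // IsGlobalGerm D B f} → ℂ) :=
  let G : AddSubgroup ({f : ∀ n : ℕ, MatTuple d n → ℂ // IsGlobalGerm D B f} → ℂ) :=
    { carrier := Set.range fun γ : EssPath D X X => monodromy B γ
      zero_mem' := ⟨refl X (hBD n hX), monodromy_refl hBD hX⟩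
      add_mem' := by
        rintro _ _ ⟨γ, rfl⟩ ⟨δ, rfl⟩
        exact ⟨γ.comp δ, monodromy_comp hBD hB hX hn γ δ⟩
      neg_mem' := by
        rintro _ ⟨γ, rfl⟩
        exact ⟨γ.symm, monodromy_symm hBD hB hX hn γ⟩ }
  { G with
    smul_mem' := by
      have hdiv : ∀ m : ℕ, 0 < m → ∀ v ∈ G, (m : ℚ)⁻¹ • v ∈ G := by
        rintro m hm _ ⟨γ, rfl⟩
        -- Adding `(m - 1) * γ.l` constant blocks gives `δ.l = m * γ.l`, so the monodromy is divided
        -- by `m`.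
        obtain ⟨δ, hδ, h⟩ := exists_monodromy_div hBD hB hX γ ((m - 1) * γ.l)
        refine ⟨δ, funext fun f => ?_⟩
        have hδ' : δ.l = m * γ.l := by
          obtain ⟨m, rfl⟩ := Nat.exists_eq_succ_of_ne_zero hm.ne'
          rw [hδ, Nat.succ_eq_add_one, Nat.add_sub_cancel]; ring
        have h1 := h f
        have hl : (γ.l : ℂ) ≠ 0 := Nat.cast_ne_zero.2 γ.l_pos.ne'
        have hm' : (m : ℂ) ≠ 0 := Nat.cast_ne_zero.2 hm.ne'
        rw [hδ'] at h1
        push_cast at h1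
        simp only [Pi.smul_apply, Rat.smul_def]
        push_cast
        field_simp
        apply mul_left_cancel₀ hl
        linear_combination h1
      intro q v hv
      have h1 := G.zsmul_mem (hdiv q.den q.den_pos v hv) q.num
      have h2 : q • v = q.num • (q.den : ℚ)⁻¹ • v := by
        rw [← Int.cast_smul_eq_zsmul ℚ, smul_smul, ← div_eq_mul_inv, Rat.num_div_den]
      rw [h2]
      exact h1 }

end EssPath

/-- The tracial fundamental group as the rational vector space of monodromies. -/
noncomputable def TracialFundamentalGroup.equivMonodromy {D B : FreeSet d} {n : ℕ}
    {X : MatTuple d n} (hBD : ∀ n, B.level n ⊆ D.level n) (hB : B.IsOpen) (hX : X ∈ B.level n)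
    (hn : 0 < n) :
    TracialFundamentalGroup D B X ≃ EssPath.monodromySubmodule (D := D) hBD hB hX hn :=
  Equiv.ofBijective
    (Quotient.lift (fun γ => ⟨EssPath.monodromy B γ, γ, rfl⟩) fun γ δ h =>
      Subtype.ext ((EssPath.traceEquiv_iff hBD hB hX hn γ δ).1 h))
    ⟨by
      rintro ⟨γ⟩ ⟨δ⟩ h
      exact Quotient.sound ((EssPath.traceEquiv_iff hBD hB hX hn γ δ).2 (congrArg Subtype.val h)),
    by
      rintro ⟨_, γ, rfl⟩
      exact ⟨mk B γ, rfl⟩⟩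

end TracialFree

/-! ### The group structure on trace classes -/

theorem mainTheorem2 {d : ℕ} (D : TracialFree.FreeSet d) (hDopen : D.IsOpen)
    (hDconn : D.IsConnected) (B : TracialFree.FreeSet d) (hB : TracialFree.FreeSet.IsAnchor D B)
    {n : ℕ} (X : TracialFree.MatTuple d n) (hX : X ∈ B.level n) :
    ∃ _ : AddCommGroup (TracialFree.TracialFundamentalGroup D B X),
      (∀ γ₁ γ₂ : TracialFree.EssPath D X X,
        TracialFree.TracialFundamentalGroup.mk B (γ₂.comp γ₁) =
          TracialFree.TracialFundamentalGroup.mk B γ₂ +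
            TracialFree.TracialFundamentalGroup.mk B γ₁) ∧
      TracialFree.TracialFundamentalGroup.mk B (TracialFree.EssPath.refl X (hB.subset n hX)) = 0 ∧
      (∀ γ : TracialFree.EssPath D X X,
        TracialFree.TracialFundamentalGroup.mk B γ.symm =
          -TracialFree.TracialFundamentalGroup.mk B γ) ∧
      Countable (TracialFree.TracialFundamentalGroup D B X) ∧
      (∀ (k : ℕ) (a : TracialFree.TracialFundamentalGroup D B X), k ≠ 0 → k • a = 0 → a = 0) ∧
      (∀ (k : ℕ) (a : TracialFree.TracialFundamentalGroup D B X), k ≠ 0 → ∃ b, k • b = a) ∧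
      ∃ ι : Type, Nonempty (TracialFree.TracialFundamentalGroup D B X ≃+ ⨁ _ : ι, ℚ) := by
  have hn : 0 < n := by
    rcases Nat.eq_zero_or_pos n with rfl | hn
    · rw [B.level_zero] at hX
      exact hX.elim
    · exact hn
  let e := TracialFree.TracialFundamentalGroup.equivMonodromy (D := D) hB.subset hB.isOpen hX hn
  -- Addition is transported from the monodromies; that concatenation induces it, and so respects
  -- trace classes, is `monodromy_comp`.
  let _ := e.addCommGroup
  let e' : TracialFree.TracialFundamentalGroup D B X ≃+
      TracialFree.EssPath.monodromySubmodule (D := D) hB.subset hB.isOpen hX hn := e.addEquiv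
  refine ⟨e.addCommGroup, fun γ₁ γ₂ => ?_, ?_, fun γ => ?_, ?_, fun k a hk ha => ?_,
    fun k a hk => ?_, ?_⟩
  · apply e'.injective
    rw [map_add]
    exact Subtype.ext (TracialFree.EssPath.monodromy_comp hB.subset hB.isOpen hX hn γ₂ γ₁)
  · apply e'.injective
    rw [map_zero]
    exact Subtype.ext (TracialFree.EssPath.monodromy_refl hB.subset hX)
  · apply e'.injective
    rw [map_neg]
    exact Subtype.ext (TracialFree.EssPath.monodromy_symm hB.subset hB.isOpen hX hn γ)
  · have hc : Countable (TracialFree.EssPath.monodromySubmodule (D := D) hB.subset hB.isOpen hX hn) :=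
      (TracialFree.EssPath.countable_range_monodromy hDopen hX).to_subtype
    exact e.countable_iff.2 hc
  · apply e'.injective
    have h := congrArg e' ha
    rw [map_nsmul, map_zero, ← Nat.cast_smul_eq_nsmul ℚ] at h
    rw [map_zero]
    exact (smul_eq_zero.1 h).resolve_left (Nat.cast_ne_zero.2 hk)
  · refine ⟨e'.symm ((k : ℚ)⁻¹ • e' a), e'.injective ?_⟩
    rw [map_nsmul, e'.apply_symm_apply, ← Nat.cast_smul_eq_nsmul ℚ, smul_smul,
      mul_inv_cancel₀ (Nat.cast_ne_zero.2 hk), one_smul]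
  · let b := Module.Basis.ofVectorSpace ℚ
      (TracialFree.EssPath.monodromySubmodule (D := D) hB.subset hB.isOpen hX hn)
    classical
    exact ⟨_, ⟨e'.trans (b.repr.trans (finsuppLEquivDirectSum ℚ ℚ _)).toAddEquiv⟩⟩
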